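/- All graphs are finite and may have loops and multiple edges. A plane graph is a graph cellularly embedded in the sphere (every region is an open disc; in particular it is connected). A graph is Eulerian if it is connected and has a closed walk traversing every edge exactly once. For an embedded graph $H$ and a set $B$ of its edges, $H|_B$ denotes the subgraph with edge set $B$ whose vertices are the vertices of $H$ incident with an edge in $B$. $G^*$ is the geometric dual of $G$, whose edge set is identified with $E(G)$ in the natural way. For $A\subseteq E(G)$ put $A^c=E(G)\setminus A$. The partial dual $G^A$ is the cellularly embedded graph obtained as follows: regard $G$ as a ribbon graph (a surface with boundary that is a union of vertex discs and edge discs); for each edge $e\in A^c$ delete the edge disc and record the two arcs along which it was attached to vertex discs by two arrows coloured $e$ that follow an orientation of the boundary of the edge disc; take the geometric dual of the resulting ribbon graph, i.e. glue new vertex discs to all its boundary components and discard the interiors of the old vertex discs, keeping the edge discs in $A$ and the arrows (which now lie on the boundaries of the new vertex discs); finally, for each $e\in A^c$, re-attach an edge disc along the two arrows coloured $e$ according to their directions. **Theorem.** Let $G$ be a plane graph and $A\subseteq E(G)$. Then 1. $G^A$ is bipartite if and only if every connected component of $G|_A$ and every connected component of $G^*|_{A^c}$ is Eulerian; 2. $G^A$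 is Eulerian if and only if $G|_A$ and $G^*|_{A^c}$ are both bipartite. -/

import Mathlib

/-! ### Abstract multigraphs -/

namespace Graph

open scoped Graph

/-- A proper 2-colouring of the vertices exists (in particular there are no loops). -/
def Bipartite {α β : Type*} (H : Graph α β) : Prop :=
  ∃ c : α → Bool, ∀ ⦃e x y⦄, H.IsLink e x y → c x ≠ c y

/-- `H` is nonempty and any two of its vertices are joined by a path. -/
def Connected {α β : Type*} (H : Graph α β) : Prop :=
  V(H).Nonempty ∧ ∀ ⦃x y⦄, x ∈ V(H) → y ∈ V(H) → Relation.ReflTransGen H.Adj x y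

/-- `C` is a connected component of `H`: a maximal connected subgraph. -/
def IsComponent {α β : Type*} (C H : Graph α β) : Prop :=
  Maximal (fun K : Graph α β => K ≤ H ∧ K.Connected) C

/-- `H.IsWalk x l y`: there is a walk in `H` from `x` to `y` whose successive edges are `l`. -/
inductive IsWalk {α β : Type*} (H : Graph α β) : α → List β → α → Prop
  | nil {x : α} : x ∈ V(H) → IsWalk H x [] x
  | cons {x y z : α} {e : β} {l : List β} :
      H.IsLink e x y → IsWalk H y l z → IsWalk H x (e :: l) z

/-- `H` is connected and has an Euler circuit: a closed walk traversing every edge exactly once. -/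
def Eulerian {α β : Type*} (H : Graph α β) : Prop :=
  H.Connected ∧ ∃ (x : α) (l : List β), H.IsWalk x l x ∧ l.Nodup ∧ ∀ e ∈ E(H), e ∈ l

/-- The subgraph induced by an edge set `A`: its edges are those of `A`, its vertices are the
vertices incident with an edge of `A`. -/
def edgeInduce {α β : Type*} (H : Graph α β) (A : Set β) : Graph α β :=
  (H.restrict A).induce {x | ∃ e ∈ A, H.Inc e x}

end Graph

/-! ### Ribbon graphs (equivalently, cellularly embedded graphs) -/

/-- A (possibly non-orientable, possibly disconnected) ribbon graph with edge set `E`, described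
by its flags.  Every edge disc meets the vertex discs in two disjoint arcs; the four end points
of these arcs are the *flags* of the edge, and `F` is the set of all flags.  Every flag `f` is an
end point of exactly three boundary arcs, whose other end points are

* `τ₂ f`, along the arc in which the edge disc is glued to a vertex disc;
* `τ₀ f`, along the free side of the edge disc;
* `τ₁ f`, along the free arc of the boundary of the vertex disc, up to the next edge end.

The vertex discs that meet no edge have no flags; they are listed separately by `V₀`.  Up to
homeomorphism a ribbon graph is the same thing as these data. -/
structure RibbonGraph (F E V₀ : Type*) where
  /-- the edge to which a flag belongs -/
  edge : F → E
  /-- the other end of the same side of the edge disc -/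
  τ₀ : F → F
  /-- the other end of the same free arc of the vertex boundary -/
  τ₁ : F → F
  /-- the other end of the same arc of attachment -/
  τ₂ : F → F
  τ₀_invol : ∀ f, τ₀ (τ₀ f) = f
  τ₁_invol : ∀ f, τ₁ (τ₁ f) = f
  τ₂_invol : ∀ f, τ₂ (τ₂ f) = f
  τ₀_τ₂ : ∀ f, τ₀ (τ₂ f) = τ₂ (τ₀ f)
  τ₀_ne : ∀ f, τ₀ f ≠ f
  τ₁_ne : ∀ f, τ₁ f ≠ f
  τ₂_ne : ∀ f, τ₂ f ≠ f
  τ₀_τ₂_ne : ∀ f, τ₀ (τ₂ f) ≠ f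
  edge_surj : Function.Surjective edge
  /-- two flags belong to the same edge iff they are corners of the same edge disc -/
  edge_eq_iff : ∀ f g, edge f = edge g ↔ g = f ∨ g = τ₀ f ∨ g = τ₂ f ∨ g = τ₀ (τ₂ f)

namespace RibbonGraph

variable {F E V₀ : Type*}

theorem edge_τ₀ (G : RibbonGraph F E V₀) (f : F) : G.edge (G.τ₀ f) = G.edge f :=
  ((G.edge_eq_iff _ _).2 (Or.inr (Or.inl rfl))).symm

theorem edge_τ₂ (G : RibbonGraph F E V₀) (f : F) : G.edge (G.τ₂ f) = G.edge f :=
  ((G.edge_eq_iff _ _).2 (Or.inr (Or.inr (Or.inl rfl)))).symm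

/-- Being in the same orbit under the two maps `σ` and `τ`. -/
def orbitSetoid (σ τ : F → F) : Setoid F :=
  Relation.EqvGen.setoid fun f g => g = σ f ∨ g = τ f

/-- The vertices: boundary circles of the vertex discs that meet an edge (these circles are
traced by alternating `τ₁` and `τ₂`), and the isolated vertices. -/
def Vertex (G : RibbonGraph F E V₀) : Type _ :=
  Quotient (orbitSetoid G.τ₁ G.τ₂) ⊕ V₀

/-- The faces: boundary components of the ribbon graph (traced by alternating `τ₁` and `τ₀`, or
the whole boundary of an isolated vertex). -/
def Face (G : RibbonGraph F E V₀) : Type _ :=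
  Quotient (orbitSetoid G.τ₁ G.τ₀) ⊕ V₀

/-- The vertex at which a flag lies. -/
def vertexOf (G : RibbonGraph F E V₀) (f : F) : G.Vertex :=
  Sum.inl (Quotient.mk (orbitSetoid G.τ₁ G.τ₂) f)

theorem vertexOf_τ₂ (G : RibbonGraph F E V₀) (f : F) : G.vertexOf (G.τ₂ f) = G.vertexOf f :=
  congrArg Sum.inl (Quotient.sound (s := orbitSetoid G.τ₁ G.τ₂)
    (Relation.EqvGen.symm _ _ (Relation.EqvGen.rel f (G.τ₂ f) (Or.inr rfl))))

/-- The underlying abstract graph: the ends of the edge `e` are the vertices at the two ends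
`f`, `τ₀ f` of a side of the edge disc of `e`. -/
def toGraph (G : RibbonGraph F E V₀) : Graph G.Vertex E where
  vertexSet := Set.univ
  IsLink e x y := ∃ f, G.edge f = e ∧ G.vertexOf f = x ∧ G.vertexOf (G.τ₀ f) = y
  isLink_symm := by
    intro e _
    refine ⟨?_⟩
    rintro x y ⟨f, he, hx, hy⟩
    exact ⟨G.τ₀ f, (G.edge_τ₀ f).trans he, hy, by rw [G.τ₀_invol]; exact hx⟩
  eq_or_eq_of_isLink_of_isLink := by
    rintro e x y v w ⟨f, he, rfl, rfl⟩ ⟨g, he', rfl, rfl⟩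
    rcases (G.edge_eq_iff f g).1 (he.trans he'.symm) with h | h | h | h
    · exact Or.inl (by rw [h])
    · exact Or.inr (by rw [h, G.τ₀_invol])
    · exact Or.inl (by rw [h, G.vertexOf_τ₂])
    · exact Or.inr (by rw [h, G.τ₀_invol, G.vertexOf_τ₂])
  left_mem_of_isLink := by
    intro _ _ _ _
    trivial

/-- A plane graph: a graph cellularly embedded in the sphere, i.e. a connected ribbon graph such
that the closed surface obtained by capping off its boundary components is a sphere, which for a
closed connected surface means Euler characteristic `v - e + f = 2`. -/
def IsPlane (G : RibbonGraph F E V₀) : Prop :=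
  G.toGraph.Connected ∧
    (Nat.card G.Vertex : ℤ) - (Nat.card E : ℤ) + (Nat.card G.Face : ℤ) = 2

/-- The geometric dual: the new vertex discs fill in the boundary components, the edge discs are
kept, and the sides of the edge discs exchange roles with the arcs of attachment. -/
def dual (G : RibbonGraph F E V₀) : RibbonGraph F E V₀ where
  edge := G.edge
  τ₀ := G.τ₂
  τ₁ := G.τ₁
  τ₂ := G.τ₀
  τ₀_invol := G.τ₂_invol
  τ₁_invol := G.τ₁_invol
  τ₂_invol := G.τ₀_invol
  τ₀_τ₂ f := (G.τ₀_τ₂ f).symm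
  τ₀_ne := G.τ₂_ne
  τ₁_ne := G.τ₁_ne
  τ₂_ne := G.τ₀_ne
  τ₀_τ₂_ne f := by rw [← G.τ₀_τ₂]; exact G.τ₀_τ₂_ne f
  edge_surj := G.edge_surj
  edge_eq_iff f g := by
    rw [G.edge_eq_iff, ← G.τ₀_τ₂]
    tauto

end RibbonGraph

/-- An arrow-marked ribbon graph.  The labels in `marked` are not edges of the ribbon graph: for
such a label the two arcs `{f, τ₂ f}` and `{τ₀ f, τ₂ (τ₀ f)}` on vertex boundaries carry the two
marking arrows of that colour, one arrow running from `f` to `τ₂ f` and the other one from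
`τ₂ (τ₀ f)` to `τ₀ f` (so `τ₀` only records which ends of the two arrows are to be joined when
the edge is put back).  All other labels are genuine ribbon edges. -/
structure ArrowMarkedRibbonGraph (F E V₀ : Type*) where
  /-- the ribbon graph described, i.e. the one with all the marked edges put back -/
  described : RibbonGraph F E V₀
  /-- the colours of the marking arrows -/
  marked : Set E

/-- Replace the edges in `B` by marking arrows. -/
def RibbonGraph.hide {F E V₀ : Type*} (G : RibbonGraph F E V₀) (B : Set E) :
    ArrowMarkedRibbonGraph F E V₀ :=
  ⟨G, B⟩

namespace ArrowMarkedRibbonGraph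

variable {F E V₀ : Type*}

/-- Replace all marking arrows by edges. -/
def restore (M : ArrowMarkedRibbonGraph F E V₀) : RibbonGraph F E V₀ :=
  M.described

open Classical in
/-- Trace the boundary of the ribbon graph (without the marked edges) from a flag `f` away from
the free arc `{f, τ₁ f}`: at a ribbon edge the boundary follows the side of the edge disc, at a
marking arrow it follows the arrow, which lies on the boundary of a vertex disc. -/
noncomputable def boundaryStep (M : ArrowMarkedRibbonGraph F E V₀) (f : F) : F :=
  if M.described.edge f ∈ M.marked then M.described.τ₂ f else M.described.τ₀ f

open Classical in
/-- The remaining involution: at a ribbon edge the arc of attachment, which becomes a side of the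
edge disc in the dual; at a marking arrow the matching of the ends of the two arrows, which is
unchanged by duality. -/
noncomputable def crossStep (M : ArrowMarkedRibbonGraph F E V₀) (f : F) : F :=
  if M.described.edge f ∈ M.marked then M.described.τ₀ f else M.described.τ₂ f

/-- The geometric dual of an arrow-marked ribbon graph: the new vertex discs fill in the boundary
components, the ribbon edges are kept, and the marking arrows, which lie on boundary components,
are carried over to the new vertices. -/
noncomputable def dual (M : ArrowMarkedRibbonGraph F E V₀) : ArrowMarkedRibbonGraph F E V₀ where
  marked := M.marked
  described :=
    { edge := M.described.edge
      τ₀ := M.crossStep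
      τ₁ := M.described.τ₁
      τ₂ := M.boundaryStep
      τ₀_invol := fun f => by
        by_cases h : M.described.edge f ∈ M.marked <;>
          simp [crossStep, h, RibbonGraph.edge_τ₀, RibbonGraph.edge_τ₂,
            M.described.τ₀_invol, M.described.τ₂_invol]
      τ₁_invol := M.described.τ₁_invol
      τ₂_invol := fun f => by
        by_cases h : M.described.edge f ∈ M.marked <;>
          simp [boundaryStep, h, RibbonGraph.edge_τ₀, RibbonGraph.edge_τ₂,
            M.described.τ₀_invol, M.described.τ₂_invol]
      τ₀_τ₂ := fun f => by
        by_cases h : M.described.edge f ∈ M.marked <;>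
          simp [boundaryStep, crossStep, h, RibbonGraph.edge_τ₀, RibbonGraph.edge_τ₂,
            M.described.τ₀_τ₂]
      τ₀_ne := fun f => by
        by_cases h : M.described.edge f ∈ M.marked <;>
          simp [crossStep, h, M.described.τ₀_ne, M.described.τ₂_ne]
      τ₁_ne := M.described.τ₁_ne
      τ₂_ne := fun f => by
        by_cases h : M.described.edge f ∈ M.marked <;>
          simp [boundaryStep, h, M.described.τ₀_ne, M.described.τ₂_ne]
      τ₀_τ₂_ne := fun f => by
        have h2 := M.described.τ₀_τ₂_ne f
        by_cases h : M.described.edge f ∈ M.marked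
        · simpa [boundaryStep, crossStep, h, RibbonGraph.edge_τ₂] using h2
        · simpa [boundaryStep, crossStep, h, RibbonGraph.edge_τ₀, M.described.τ₀_τ₂] using h2
      edge_surj := M.described.edge_surj
      edge_eq_iff := fun f g => by
        rw [M.described.edge_eq_iff]
        by_cases h : M.described.edge f ∈ M.marked
        · simp [boundaryStep, crossStep, h, RibbonGraph.edge_τ₂]
        · simp only [boundaryStep, crossStep, h, RibbonGraph.edge_τ₀, if_false,
            M.described.τ₀_τ₂]
          tauto }

end ArrowMarkedRibbonGraph

/-- The partial dual `G^A`: hide the edges not in `A` by marking arrows, form the geometric dual,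
and put the hidden edges back. -/
noncomputable def RibbonGraph.partialDual {F E V₀ : Type*} (G : RibbonGraph F E V₀) (A : Set E) :
    RibbonGraph F E V₀ :=
  (G.hide Aᶜ).dual.restore

/-! Everything is expressed by functions modulo two on the flags that are constant along the free
arcs of the vertex boundaries, i.e. invariant under `τ₁`. A subgraph with edge set `B` has even
degrees iff some such function jumps, across the arcs of attachment, exactly at the edges of `B`: it
is a checkerboard colouring of the free arcs around the vertices. The subgraph is bipartite iff some
such function does not jump across any arc of attachment and jumps along the sides of the edges in
`B`. Since the partial dual exchanges the sides and the arcs of attachment of the edges in `A`, it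
is bipartite iff a single function is a checkerboard colouring both for `A` in `G` and for `Aᶜ` in
`G*`; and it has even degrees iff some function jumps along the sides of the edges in `A` and across
the arcs of attachment of the edges in `Aᶜ`.

It remains to pass between one function for `G^A` and a pair of functions for `G` and `G*`. By
Euler's formula the cuts of `G` and the cuts of `G*` are orthogonal complements on the sphere, so
every function whose values at the four corners of each edge add up to zero is the sum of a function
on the vertices and a function on the faces. -/

/-! ### Linear algebra on finite coordinate spaces -/

theorem mem_of_forall_dotProduct_eq_zero {K ι : Type*} [Field K] [Fintype ι]
    {p q : Submodule K (ι → K)} (hpq : ∀ a ∈ p, ∀ b ∈ q, b ⬝ᵥ a = 0)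
    (hdim : Fintype.card ι ≤ Module.finrank K p + Module.finrank K q) {a : ι → K}
    (ha : ∀ b ∈ q, b ⬝ᵥ a = 0) : a ∈ p := by
  classical
  let orth : Submodule K (ι → K) := (q.map (dotProductEquiv K ι).toLinearMap).dualCoannihilator
  have mem_orth : ∀ c, c ∈ orth ↔ ∀ b ∈ q, b ⬝ᵥ c = 0 := fun c => by
    simp only [orth, Submodule.mem_dualCoannihilator, Submodule.mem_map, forall_exists_index,
      and_imp, forall_apply_eq_imp_iff₂]
    rfl
  have finrank_orth : Module.finrank K q + Module.finrank K orth = Fintype.card ι := by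
    rw [← Module.finrank_fintype_fun_eq_card K,
      ← LinearEquiv.finrank_map_eq (dotProductEquiv K ι) q]
    exact Subspace.finrank_add_finrank_dualCoannihilator_eq _
  have hp : p = orth := Submodule.eq_of_le_of_finrank_le
    (fun c hc => (mem_orth c).2 (hpq c hc)) (by omega)
  rwa [hp, mem_orth]

/-- The map `g ↦ g + g ∘ σ`.  In characteristic two and for an involution `σ`, its kernel consists
of the `σ`-invariant functions and its values are `σ`-invariant. -/
def symmetrize (K : Type*) {ι : Type*} [CommSemiring K] (σ : ι → ι) : (ι → K) →ₗ[K] ι → K :=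
  LinearMap.id + LinearMap.funLeft K K σ

theorem symmetrize_apply {K ι : Type*} [CommSemiring K] (σ : ι → ι) (g : ι → K) (i : ι) :
    symmetrize K σ g i = g i + g (σ i) := rfl

theorem symmetrize_apply_involutive {K ι : Type*} [CommSemiring K] {σ : ι → ι}
    (hσ : σ.Involutive) (g : ι → K) (i : ι) : symmetrize K σ g (σ i) = symmetrize K σ g i := by
  rw [symmetrize_apply, symmetrize_apply, hσ, add_comm]

theorem dotProduct_symmetrize {K ι : Type*} [CommSemiring K] [Fintype ι] {σ : ι → ι}
    (hσ : σ.Involutive) (g h : ι → K) :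
    g ⬝ᵥ symmetrize K σ h = symmetrize K σ g ⬝ᵥ h := by
  have hswap : ∑ i, g i * h (σ i) = ∑ i, g (σ i) * h i := by
    rw [← Equiv.sum_comp hσ.toPerm]
    simp [hσ _]
  simp only [dotProduct, symmetrize_apply, mul_add, add_mul, Finset.sum_add_distrib, hswap]

/-- The Fredholm alternative for `symmetrize K σ ∘ symmetrize K τ`, whose transpose is
`symmetrize K τ ∘ symmetrize K σ`. -/
theorem exists_symmetrize_symmetrize_eq {K ι : Type*} [Field K] [Fintype ι] {σ τ : ι → ι}
    (hσ : σ.Involutive) (hτ : τ.Involutive) {s : ι → K}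
    (hs : ∀ w, symmetrize K τ (symmetrize K σ w) = 0 → w ⬝ᵥ s = 0) :
    ∃ h, symmetrize K σ (symmetrize K τ h) = s := by
  classical
  by_contra hne
  obtain ⟨φ, hφ, hker⟩ := Submodule.exists_le_ker_of_notMem
    (p := LinearMap.range (symmetrize K σ ∘ₗ symmetrize K τ)) (v := s) hne
  obtain ⟨w, rfl⟩ := (dotProductEquiv K ι).surjective φ
  refine hφ (hs w ?_)
  refine dotProduct_eq_zero _ fun h => ?_
  rw [← dotProduct_symmetrize hτ, ← dotProduct_symmetrize hσ]
  exact hker ⟨h, rfl⟩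

theorem sum_eq_zero_of_comp_involutive {R ι : Type*} [Semiring R] [CharP R 2] [Fintype ι]
    {τ : ι → ι} (hτ : τ.Involutive) (hne : ∀ i, τ i ≠ i) {g : ι → R} (hg : ∀ i, g (τ i) = g i) :
    ∑ i, g i = 0 :=
  Finset.sum_involution (fun i _ => τ i) (fun i _ => by rw [hg, CharTwo.add_self_eq_zero])
    (fun i _ _ => hne i) (fun _ _ => Finset.mem_univ _) (fun i _ => hτ i)

namespace Multigraph

open Graph
open scoped Graph

variable {α β : Type*} {H C : Graph α β} {x y z : α} {e : β} {l l' : List β}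

/-! ### Coboundaries and degrees modulo two -/

open Classical in
/-- The coboundary map modulo two: the value of `coboundary H c` at an edge is the sum of the values
of `c` at its two ends, and `0` off the edge set of `H`. -/
noncomputable def coboundary (H : Graph α β) : (α → ZMod 2) →ₗ[ZMod 2] β → ZMod 2 :=
  LinearMap.pi fun e =>
    if he : e ∈ E(H) then
      .proj (φ := fun _ => ZMod 2) (exists_isLink_of_mem_edgeSet he).choose +
        .proj (exists_isLink_of_mem_edgeSet he).choose_spec.choose
    else 0

theorem coboundary_of_isLink (h : H.IsLink e x y) (c : α → ZMod 2) :
    coboundary H c e = c x + c y := by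
  have he := exists_isLink_of_mem_edgeSet h.edge_mem
  have hdef : coboundary H c e = c he.choose + c he.choose_spec.choose := by
    simp [coboundary, h.edge_mem]
  rcases he.choose_spec.choose_spec.eq_and_eq_or_eq_and_eq h with ⟨hx, hy⟩ | ⟨hy, hx⟩
  · rw [hdef, hy, hx]
  · rw [hdef, hx, hy, add_comm]

theorem coboundary_of_notMem (he : e ∉ E(H)) (c : α → ZMod 2) : coboundary H c e = 0 := by
  simp [coboundary, he]

open Classical in
theorem coboundary_single [DecidableEq α] (x : α) (e : β) :
    coboundary H (Pi.single x 1) e = if H.IsNonloopAt e x then 1 else 0 := by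
  split_ifs with h
  · obtain ⟨y, hyx, hxy⟩ := h
    simp [coboundary_of_isLink hxy, hyx]
  · by_cases he : e ∈ E(H)
    · obtain ⟨u, v, huv⟩ := exists_isLink_of_mem_edgeSet he
      have hiff : u = x ↔ v = x := by
        constructor <;> rintro rfl <;> by_contra hne
        exacts [h ⟨v, hne, huv⟩, h ⟨u, hne, huv.symm⟩]
      by_cases hu : u = x
      · rw [coboundary_of_isLink huv, hiff.1 hu, hu, CharTwo.add_self_eq_zero]
      · simp [coboundary_of_isLink huv, hu, mt hiff.2 hu]
    · exact coboundary_of_notMem he _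

theorem eq_of_reflTransGen_adj {c : α → ZMod 2} (hc : coboundary H c = 0)
    (h : Relation.ReflTransGen H.Adj x y) : c y = c x := by
  induction h with
  | refl => rfl
  | @tail u v _ huv ih =>
    obtain ⟨e, he⟩ := huv
    have hcuv : c u + c v = 0 := by rw [← coboundary_of_isLink he, hc, Pi.zero_apply]
    rw [← ih, CharTwo.add_eq_zero.1 hcuv]

theorem finrank_ker_coboundary_le_one (hH : H.Connected) (hV : V(H) = Set.univ) :
    Module.finrank (ZMod 2) (LinearMap.ker (coboundary H)) ≤ 1 := by
  obtain ⟨x, hx⟩ := hH.1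
  let evalAt : LinearMap.ker (coboundary H) →ₗ[ZMod 2] ZMod 2 :=
    LinearMap.proj x ∘ₗ (LinearMap.ker (coboundary H)).subtype
  have hinj : Function.Injective evalAt := by
    rw [injective_iff_map_eq_zero]
    rintro ⟨c, hc⟩ (hcx : c x = 0)
    refine Subtype.ext (funext fun y => ?_)
    exact (eq_of_reflTransGen_adj hc (hH.2 hx (hV ▸ Set.mem_univ y))).trans hcx
  simpa using LinearMap.finrank_le_finrank_of_injective hinj

/-- Every vertex has even degree.  A loop contributes two to the degree of its vertex, so only the
other edges are counted. -/
def HasEvenDegrees (H : Graph α β) : Prop :=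
  ∀ x, Even {e | H.IsNonloopAt e x}.ncard

theorem hasEvenDegrees_iff_sum_single [Fintype β] [DecidableEq α] :
    HasEvenDegrees H ↔ ∀ x, ∑ e, coboundary H (Pi.single x 1) e = 0 := by
  classical
  refine forall_congr' fun x => ?_
  rw [← ZMod.natCast_eq_zero_iff_even, Set.ncard_eq_toFinset_card', Set.toFinset_ofPred,
    ← Finset.sum_boole]
  simp only [coboundary_single]

theorem hasEvenDegrees_iff_sum [Finite α] [Fintype β] :
    HasEvenDegrees H ↔ ∀ c, ∑ e, coboundary H c e = 0 := by
  classical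
  rw [hasEvenDegrees_iff_sum_single]
  refine ⟨fun h => ?_, fun h x => h _⟩
  let total : (α → ZMod 2) →ₗ[ZMod 2] ZMod 2 :=
    (∑ e, LinearMap.proj e) ∘ₗ coboundary H
  have htotal : total = 0 :=
    LinearMap.pi_ext' fun x => LinearMap.ext_ring (by simpa [total] using h x)
  exact fun c => by simpa [total] using LinearMap.congr_fun htotal c

/-! ### Euler circuits -/

theorem isWalk_append_iff :
    H.IsWalk x (l ++ l') z ↔ ∃ y, H.IsWalk x l y ∧ H.IsWalk y l' z := by
  constructor
  · induction l generalizing x with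
    | nil =>
      intro h
      refine ⟨x, .nil ?_, h⟩
      cases h with
      | nil hx => exact hx
      | cons he _ => exact he.left_mem
    | cons e l ih =>
      rintro (_ | ⟨he, h⟩)
      obtain ⟨y, hl, hl'⟩ := ih h
      exact ⟨y, .cons he hl, hl'⟩
  · rintro ⟨y, hl, hl'⟩
    induction hl with
    | nil _ => exact hl'
    | cons he _ ih => exact .cons he (ih hl')

theorem isWalk_concat (h : H.IsWalk x l y) (he : H.IsLink e y z) : H.IsWalk x (l ++ [e]) z :=
  isWalk_append_iff.2 ⟨y, h, .cons he (.nil he.right_mem)⟩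

theorem sum_coboundary_of_isWalk (h : H.IsWalk x l y) (c : α → ZMod 2) :
    (l.map (coboundary H c)).sum = c x + c y := by
  induction h with
  | nil _ => exact (CharTwo.add_self_eq_zero _).symm
  | @cons x y z e l he _ ih =>
    rw [List.map_cons, List.sum_cons, ih, coboundary_of_isLink he]
    linear_combination CharTwo.add_self_eq_zero (c y)

theorem sum_eq_list_sum_of_nodup {M : Type*} [AddCommMonoid M] [Fintype β] {f : β → M}
    (hl : l.Nodup) (hf : ∀ e ∉ l, f e = 0) : ∑ e, f e = (l.map f).sum := by
  classical
  rw [← List.sum_toFinset f hl]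
  exact (Finset.sum_subset (Finset.subset_univ _) fun e _ he => hf e (by simpa using he)).symm

theorem hasEvenDegrees_of_eulerian [Finite β] (hH : H.Eulerian) : HasEvenDegrees H := by
  classical
  have := Fintype.ofFinite β
  obtain ⟨-, x, l, hwalk, hl, hcover⟩ := hH
  refine hasEvenDegrees_iff_sum_single.2 fun y => ?_
  rw [sum_eq_list_sum_of_nodup hl fun e he => coboundary_of_notMem (mt (hcover e) he) _,
    sum_coboundary_of_isWalk hwalk, CharTwo.add_self_eq_zero]

theorem exists_isLink_notMem_of_isWalk [Finite β] (hH : HasEvenDegrees H) (hwalk : H.IsWalk x l y)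
    (hl : l.Nodup) (hxy : x ≠ y) : ∃ e z, e ∉ l ∧ H.IsLink e y z := by
  classical
  have := Fintype.ofFinite β
  by_contra! hstuck
  have hzero : ∀ e ∉ l, coboundary H (Pi.single y 1) e = 0 := fun e he => by
    rw [coboundary_single, if_neg]
    rintro ⟨z, -, hz⟩
    exact hstuck e z he hz
  have hsum := hasEvenDegrees_iff_sum_single.1 hH y
  rw [sum_eq_list_sum_of_nodup hl hzero, sum_coboundary_of_isWalk hwalk] at hsum
  simp [hxy] at hsum

theorem exists_perm_isWalk_of_mem (hwalk : H.IsWalk x l x) (he : H.IsLink e y z) (hel : e ∈ l) :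
    ∃ l', l'.Perm l ∧ H.IsWalk y l' y := by
  obtain ⟨l₁, l₂, rfl⟩ := List.append_of_mem hel
  obtain ⟨u, hl₁, h⟩ := isWalk_append_iff.1 hwalk
  obtain _ | ⟨huv, hl₂⟩ := h
  rcases he.eq_and_eq_or_eq_and_eq huv with ⟨rfl, rfl⟩ | ⟨rfl, rfl⟩
  · exact ⟨e :: (l₂ ++ l₁), (List.perm_append_comm.cons e).trans List.perm_middle.symm,
      .cons huv (isWalk_append_iff.2 ⟨x, hl₂, hl₁⟩)⟩
  · refine ⟨l₂ ++ (l₁ ++ [e]), ?_, isWalk_append_iff.2 ⟨x, hl₂, isWalk_concat hl₁ huv⟩⟩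
    simpa using List.perm_append_comm (l₁ := l₂) (l₂ := l₁ ++ [e])

theorem exists_longer_trail_of_notMem (hH : H.Connected) (hwalk : H.IsWalk x l x) (hl : l.Nodup)
    (he : e ∈ E(H)) (hel : e ∉ l) :
    ∃ y z l', H.IsWalk y l' z ∧ l'.Nodup ∧ l'.length = l.length + 1 := by
  by_contra! hmax
  have hmem : ∀ {u v f l'}, l'.Perm l → H.IsWalk u l' u → H.IsLink f u v → f ∈ l := by
    intro u v f l' hperm hl' hf
    by_contra hfl
    refine hmax v u (f :: l') (.cons hf.symm hl') ?_ (by simp [hperm.length_eq])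
    exact List.nodup_cons.2 ⟨mt hperm.mem_iff.1 hfl, hperm.nodup_iff.2 hl⟩
  have hrotate : ∀ u, Relation.ReflTransGen H.Adj x u → ∃ l', l'.Perm l ∧ H.IsWalk u l' u := by
    intro u hu
    induction hu with
    | refl => exact ⟨l, .refl l, hwalk⟩
    | tail _ huv ih =>
      obtain ⟨l', hperm, hl'⟩ := ih
      obtain ⟨f, hf⟩ := huv
      exact exists_perm_isWalk_of_mem hwalk hf.symm (hmem hperm hl' hf)
  obtain ⟨u, v, huv⟩ := exists_isLink_of_mem_edgeSet he
  have hx : x ∈ V(H) := by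
    obtain hx | ⟨hx, -⟩ := hwalk
    exacts [hx, hx.left_mem]
  obtain ⟨l', hperm, hl'⟩ := hrotate u (hH.2 hx huv.left_mem)
  exact hel (hmem hperm hl' huv)

theorem eulerian_of_hasEvenDegrees [Finite β] (hH : H.Connected) (heven : HasEvenDegrees H) :
    H.Eulerian := by
  by_contra hnot
  have htrail : ∀ n, ∃ x y l, H.IsWalk x l y ∧ l.Nodup ∧ l.length = n := by
    intro n
    induction n with
    | zero =>
      obtain ⟨x, hx⟩ := hH.1
      exact ⟨x, x, [], .nil hx, List.nodup_nil, rfl⟩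
    | succ n ih =>
      obtain ⟨x, y, l, hwalk, hl, rfl⟩ := ih
      by_cases hxy : x = y
      · subst hxy
        obtain ⟨e, he, hel⟩ : ∃ e ∈ E(H), e ∉ l := by
          by_contra! hcover
          exact hnot ⟨hH, x, l, hwalk, hl, hcover⟩
        exact exists_longer_trail_of_notMem hH hwalk hl he hel
      · obtain ⟨e, z, hel, he⟩ := exists_isLink_notMem_of_isWalk heven hwalk hl hxy
        exact ⟨x, z, l ++ [e], isWalk_concat hwalk he, by simpa using List.Nodup.concat hel hl,
          by simp⟩
  have := Fintype.ofFinite β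
  obtain ⟨-, -, l, -, hl, hlength⟩ := htrail (Fintype.card β + 1)
  exact absurd hl.length_le_card (by omega)

theorem eulerian_iff [Finite β] : H.Eulerian ↔ H.Connected ∧ HasEvenDegrees H :=
  ⟨fun h => ⟨h.1, hasEvenDegrees_of_eulerian h⟩, fun h => eulerian_of_hasEvenDegrees h.1 h.2⟩

/-! ### Connected components -/

/-- The component of `x`: the subgraph induced on the vertices that can be reached from `x`.  It is
a subgraph of `H` only if `x` is a vertex of `H`. -/
def componentOf (H : Graph α β) (x : α) : Graph α β :=
  H.induce {y | Relation.ReflTransGen H.Adj x y}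

theorem componentOf_isClosedSubgraph (hx : x ∈ V(H)) : componentOf H x ≤c H := by
  have hmem : ∀ y, Relation.ReflTransGen H.Adj x y → y ∈ V(H) := by
    rintro y (_ | ⟨-, hy⟩)
    exacts [hx, hy.right_mem]
  refine .mk' ⟨hmem, fun _ _ _ h => h.1⟩ ?_
  rintro e u ⟨v, huv⟩ hu
  exact ⟨u, v, huv, hu, Relation.ReflTransGen.tail hu ⟨e, huv⟩⟩

theorem connected_componentOf (H : Graph α β) (x : α) : (componentOf H x).Connected := by
  have hreach : ∀ y, Relation.ReflTransGen H.Adj x y →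
      Relation.ReflTransGen (componentOf H x).Adj x y := by
    intro y hy
    induction hy with
    | refl => exact .refl
    | @tail u v hu huv ih =>
      obtain ⟨e, he⟩ := huv
      exact ih.tail ⟨e, he, hu, hu.tail ⟨e, he⟩⟩
  exact ⟨⟨x, .refl⟩, fun u v hu hv =>
    (Relation.ReflTransGen.stdSymm.symm _ _ (hreach u hu)).trans (hreach v hv)⟩

theorem le_componentOf (hC : C.Connected) (hCH : C ≤ H) (hx : x ∈ V(C)) : C ≤ componentOf H x := by
  have hreach : ∀ y ∈ V(C), Relation.ReflTransGen H.Adj x y := fun y hy =>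
    Relation.ReflTransGen.mono (fun _ _ => Adj.mono hCH) _ _ (hC.2 hx hy)
  exact ⟨hreach, fun _ _ _ h => ⟨hCH.isLink_mono h, hreach _ h.left_mem, hreach _ h.right_mem⟩⟩

theorem isComponent_iff : C.IsComponent H ↔ ∃ x ∈ V(H), C = componentOf H x := by
  constructor
  · intro hC
    obtain ⟨x, hx⟩ := hC.prop.2.1
    have hxH := hC.prop.1.vertexSet_mono hx
    have hle := le_componentOf hC.prop.2 hC.prop.1 hx
    refine ⟨x, hxH, le_antisymm hle (hC.le_of_ge ⟨?_, connected_componentOf H x⟩ hle)⟩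
    exact (componentOf_isClosedSubgraph hxH).le
  · rintro ⟨x, hx, rfl⟩
    refine ⟨⟨(componentOf_isClosedSubgraph hx).le, connected_componentOf H x⟩, fun K hK hle => ?_⟩
    exact le_componentOf hK.2 hK.1 (hle.vertexSet_mono (Relation.ReflTransGen.refl : _))

theorem hasEvenDegrees_iff_forall_mem :
    HasEvenDegrees H ↔ ∀ x ∈ V(H), Even {e | H.IsNonloopAt e x}.ncard := by
  refine ⟨fun h x _ => h x, fun h x => ?_⟩
  by_cases hx : x ∈ V(H)
  · exact h x hx
  · simp [Set.eq_empty_of_forall_notMem (s := {e | H.IsNonloopAt e x}) fun _ he => hx he.vertex_mem]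

theorem setOf_isNonloopAt_of_isClosedSubgraph (hCH : C ≤c H) (hx : x ∈ V(C)) :
    {e | C.IsNonloopAt e x} = {e | H.IsNonloopAt e x} :=
  Set.ext fun _ => exists_congr fun _ => and_congr_right fun _ => hCH.isLink_congr hx

theorem forall_isComponent_eulerian_iff [Finite β] :
    (∀ C : Graph α β, C.IsComponent H → C.Eulerian) ↔ HasEvenDegrees H := by
  simp only [isComponent_iff, forall_exists_index, and_imp]
  constructor
  · intro h
    refine hasEvenDegrees_iff_forall_mem.2 fun x hx => ?_
    have hx' : x ∈ V(componentOf H x) := Relation.ReflTransGen.refl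
    rw [← setOf_isNonloopAt_of_isClosedSubgraph (componentOf_isClosedSubgraph hx) hx']
    exact (eulerian_iff.1 (h _ x hx rfl)).2 x
  · rintro h _ x hx rfl
    refine eulerian_iff.2 ⟨connected_componentOf H x, ?_⟩
    refine hasEvenDegrees_iff_forall_mem.2 fun y hy => ?_
    rw [setOf_isNonloopAt_of_isClosedSubgraph (componentOf_isClosedSubgraph hx) hy]
    exact h y

/-! ### Edge-induced subgraphs -/

theorem edgeInduce_le (H : Graph α β) (A : Set β) : H.edgeInduce A ≤ H where
  vertexSet_mono := fun _ ⟨_, _, h⟩ => h.vertex_mem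
  isLink_mono := fun _ _ _ h => h.1.2

theorem edgeSet_edgeInduce (H : Graph α β) (A : Set β) : E(H.edgeInduce A) = E(H) ∩ A := by
  ext e
  refine ⟨fun he => ?_, fun ⟨he, heA⟩ => ?_⟩
  · obtain ⟨x, y, h⟩ := exists_isLink_of_mem_edgeSet he
    exact ⟨h.1.2.edge_mem, h.1.1⟩
  · obtain ⟨x, y, h⟩ := exists_isLink_of_mem_edgeSet he
    exact IsLink.edge_mem ⟨⟨heA, h⟩, ⟨e, heA, h.inc_left⟩, ⟨e, heA, h.inc_right⟩⟩

end Multigraph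

namespace RibbonGraph

open Multigraph
open scoped Graph

variable {F E V₀ : Type*} {G G' : RibbonGraph F E V₀}

/-! ### Vertices and connectivity of ribbon graphs -/

theorem vertexOf_τ₁ (G : RibbonGraph F E V₀) (f : F) : G.vertexOf (G.τ₁ f) = G.vertexOf f :=
  congrArg Sum.inl (Quotient.sound (s := orbitSetoid G.τ₁ G.τ₂)
    (Relation.EqvGen.symm _ _ (Relation.EqvGen.rel f (G.τ₁ f) (Or.inl rfl))))

/-- The function on the vertices of `G` given by a function on the flags that is constant along
vertex boundaries, together with arbitrary values at the isolated vertices. -/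
def vertexLift {X : Type*} (c : F → X) (c₀ : V₀ → X) (h₁ : ∀ f, c (G.τ₁ f) = c f)
    (h₂ : ∀ f, c (G.τ₂ f) = c f) : G.Vertex → X :=
  Sum.elim (Quotient.lift c fun f g hfg => by
    induction hfg with
    | rel f g h => rcases h with rfl | rfl <;> simp only [h₁, h₂]
    | refl f => rfl
    | symm f g _ ih => exact ih.symm
    | trans f g k _ _ ih ih' => exact ih.trans ih') c₀

theorem vertexLift_vertexOf {X : Type*} (c : F → X) (c₀ : V₀ → X) (h₁ : ∀ f, c (G.τ₁ f) = c f)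
    (h₂ : ∀ f, c (G.τ₂ f) = c f) (f : F) : vertexLift c c₀ h₁ h₂ (G.vertexOf f) = c f := rfl

instance [Finite F] [Finite V₀] : Finite G.Vertex :=
  inferInstanceAs (Finite (Quotient _ ⊕ V₀))

theorem finite_edges [Finite F] (G : RibbonGraph F E V₀) : Finite E :=
  .of_surjective _ G.edge_surj

theorem edgeSet_toGraph (G : RibbonGraph F E V₀) : E(G.toGraph) = Set.univ := by
  refine Set.eq_univ_of_forall fun e => ?_
  obtain ⟨f, rfl⟩ := G.edge_surj e
  exact Graph.IsLink.edge_mem (G := G.toGraph) ⟨f, rfl, rfl, rfl⟩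

theorem edgeSet_edgeInduce_toGraph (G : RibbonGraph F E V₀) (A : Set E) :
    E(G.toGraph.edgeInduce A) = A := by
  rw [edgeSet_edgeInduce, edgeSet_toGraph, Set.univ_inter]

theorem reflTransGen_adj_of_edge_eq {f g : F} (h : G.edge f = G.edge g) :
    Relation.ReflTransGen G.toGraph.Adj (G.vertexOf f) (G.vertexOf g) := by
  have hadj : G.toGraph.Adj (G.vertexOf f) (G.vertexOf (G.τ₀ f)) :=
    ⟨G.edge f, f, rfl, rfl, rfl⟩
  rcases (G.edge_eq_iff f g).1 h with rfl | rfl | rfl | rfl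
  · rfl
  · exact .single hadj
  · rw [vertexOf_τ₂]
  · rw [G.τ₀_τ₂, vertexOf_τ₂]
    exact .single hadj

theorem connected_toGraph_of_edge_eq_of_τ₁_eq (hedge : G'.edge = G.edge) (hτ₁ : G'.τ₁ = G.τ₁)
    (hG : G.toGraph.Connected) : G'.toGraph.Connected := by
  refine ⟨?_, fun x' y' _ _ => ?_⟩
  · obtain ⟨⟨⟨f⟩⟩ | v, -⟩ := hG.1
    exacts [⟨G'.vertexOf f, trivial⟩, ⟨Sum.inr v, trivial⟩]
  let reached (z : G'.Vertex) : Prop := Relation.ReflTransGen G'.toGraph.Adj x' z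
  have reached_edge : ∀ {f g}, G.edge f = G.edge g →
      reached (G'.vertexOf f) → reached (G'.vertexOf g) := fun h hf =>
    hf.trans (reflTransGen_adj_of_edge_eq (hedge ▸ h))
  let reachedG : G.Vertex → Prop := vertexLift (fun f => reached (G'.vertexOf f))
    (fun v => reached (Sum.inr v)) (fun f => by rw [← hτ₁, vertexOf_τ₁])
    (fun f => propext ⟨reached_edge (G.edge_τ₂ f), reached_edge (G.edge_τ₂ f).symm⟩)
  have reachedG_all : ∀ {x}, reachedG x → ∀ y, reachedG y := fun {x} hx y => by
    induction hG.2 (Set.mem_univ x) (Set.mem_univ y) with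
    | refl => exact hx
    | tail _ h ih =>
      obtain ⟨_, f, -, rfl, rfl⟩ := h
      exact reached_edge (G.edge_τ₀ f).symm ih
  have reachedG_of_reached : ∃ x, reachedG x := by
    rcases x' with ⟨⟨f⟩⟩ | v
    exacts [⟨G.vertexOf f, Relation.ReflTransGen.refl⟩, ⟨Sum.inr v, Relation.ReflTransGen.refl⟩]
  obtain ⟨x, hx⟩ := reachedG_of_reached
  rcases y' with ⟨⟨f⟩⟩ | v
  exacts [reachedG_all hx (G.vertexOf f), reachedG_all hx (Sum.inr v)]

/-! ### Sums over flags -/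

theorem sum_edge_eq_sum_flag [Fintype F] [Fintype E] {M : Type*} [AddCommMonoid M] {b : E → M}
    {u : F → M} (h : ∀ f, b (G.edge f) = u f + u (G.τ₀ f) + u (G.τ₂ f) + u (G.τ₀ (G.τ₂ f))) :
    ∑ e, b e = ∑ f, u f := by
  classical
  rw [← Finset.sum_fiberwise (s := Finset.univ) (g := G.edge)]
  refine Finset.sum_congr rfl fun e _ => ?_
  obtain ⟨f, rfl⟩ := G.edge_surj e
  have hfiber : ({g | G.edge g = G.edge f} : Finset F) =
      {f, G.τ₀ f, G.τ₂ f, G.τ₀ (G.τ₂ f)} := by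
    ext g
    rw [Finset.mem_filter_univ, eq_comm, G.edge_eq_iff]
    simp only [Finset.mem_insert, Finset.mem_singleton]
  have h₁ : f ∉ ({G.τ₀ f, G.τ₂ f, G.τ₀ (G.τ₂ f)} : Finset F) := by
    simp [(G.τ₀_ne f).symm, (G.τ₂_ne f).symm, (G.τ₀_τ₂_ne f).symm]
  have h₂ : G.τ₀ f ∉ ({G.τ₂ f, G.τ₀ (G.τ₂ f)} : Finset F) := by
    have hτ₂ : G.τ₀ f ≠ G.τ₂ f := fun h => G.τ₀_τ₂_ne f (by rw [← h, G.τ₀_invol])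
    simp [hτ₂, G.τ₀_τ₂, (G.τ₂_ne (G.τ₀ f)).symm]
  have h₃ : G.τ₂ f ∉ ({G.τ₀ (G.τ₂ f)} : Finset F) := by
    simp [(G.τ₀_ne (G.τ₂ f)).symm]
  rw [h f, hfiber, Finset.sum_insert h₁, Finset.sum_insert h₂, Finset.sum_insert h₃,
    Finset.sum_singleton]
  simp only [add_assoc]

theorem sum_edge_eq_zero [Finite F] [Fintype E] {R : Type*} [Semiring R] [CharP R 2] {b : E → R}
    {u : F → R} (hu : ∀ f, u (G.τ₁ f) = u f)
    (h : ∀ f, b (G.edge f) = u f + u (G.τ₀ f) + u (G.τ₂ f) + u (G.τ₀ (G.τ₂ f))) :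
    ∑ e, b e = 0 := by
  have := Fintype.ofFinite F
  rw [sum_edge_eq_sum_flag h, sum_eq_zero_of_comp_involutive G.τ₁_invol G.τ₁_ne hu]

theorem exists_comp_edge_eq {X : Type*} {q : F → X} (h₀ : ∀ f, q (G.τ₀ f) = q f)
    (h₂ : ∀ f, q (G.τ₂ f) = q f) : ∃ a : E → X, ∀ f, a (G.edge f) = q f := by
  refine ⟨q ∘ Function.surjInv G.edge_surj, fun f => ?_⟩
  have hf := Function.surjInv_eq G.edge_surj (G.edge f)
  rcases (G.edge_eq_iff f _).1 hf.symm with h | h | h | h <;>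
    simp only [Function.comp_apply, h, h₀, h₂]

/-! ### Jump functions and balanced functions on the flags -/

/-- The function `h` on the flags is constant along the free arcs of the vertex boundaries, and
changes by `s e` across each arc in which the edge `e` is attached.  For `s = 0` this says that `h`
is a function on the vertices; for the indicator `s` of a set of edges it says that `h` is a
checkerboard colouring of the vertex boundaries that changes exactly at the ends of those edges. -/
structure HasJump (G : RibbonGraph F E V₀) (s : E → ZMod 2) (h : F → ZMod 2) : Prop where
  apply_τ₁ : ∀ f, h (G.τ₁ f) = h f
  apply_τ₂ : ∀ f, h (G.τ₂ f) = h f + s (G.edge f)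

/-- The function `g` on the flags is constant along the free arcs of the vertex boundaries, and its
values at the four corners of every edge disc add up to zero.  Functions on the vertices and
functions on the faces are balanced, and on a plane graph they span the balanced functions. -/
structure IsBalanced (G : RibbonGraph F E V₀) (g : F → ZMod 2) : Prop where
  apply_τ₁ : ∀ f, g (G.τ₁ f) = g f
  sum_corners : ∀ f, g f + g (G.τ₀ f) + g (G.τ₂ f) + g (G.τ₀ (G.τ₂ f)) = 0

variable {s t : E → ZMod 2} {g h : F → ZMod 2}

theorem HasJump.add (hg : G.HasJump s g) (hh : G.HasJump t h) : G.HasJump (s + t) (g + h) where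
  apply_τ₁ f := by simp only [Pi.add_apply, hg.apply_τ₁, hh.apply_τ₁]
  apply_τ₂ f := by simp only [Pi.add_apply, hg.apply_τ₂, hh.apply_τ₂, add_add_add_comm]

theorem HasJump.isBalanced (hh : G.HasJump s h) : G.IsBalanced h where
  apply_τ₁ := hh.apply_τ₁
  sum_corners f := by
    rw [G.τ₀_τ₂, hh.apply_τ₂, hh.apply_τ₂, G.edge_τ₀]
    grind

theorem IsBalanced.add (hg : G.IsBalanced g) (hh : G.IsBalanced h) : G.IsBalanced (g + h) where
  apply_τ₁ f := by simp only [Pi.add_apply, hg.apply_τ₁, hh.apply_τ₁]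
  sum_corners f := by
    simp only [Pi.add_apply]
    linear_combination hg.sum_corners f + hh.sum_corners f

theorem isBalanced_of_dual (hg : G.dual.IsBalanced g) : G.IsBalanced g where
  apply_τ₁ := hg.apply_τ₁
  sum_corners f := by
    have hcorners : g f + g (G.τ₂ f) + g (G.τ₀ f) + g (G.τ₂ (G.τ₀ f)) = 0 := hg.sum_corners f
    rw [G.τ₀_τ₂]
    linear_combination hcorners

theorem hasJump_zero_comp_vertexOf (G : RibbonGraph F E V₀) (c : G.Vertex → ZMod 2) :
    G.HasJump 0 (c ∘ G.vertexOf) where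
  apply_τ₁ f := by simp only [Function.comp_apply, vertexOf_τ₁]
  apply_τ₂ f := by simp only [Function.comp_apply, vertexOf_τ₂, Pi.zero_apply, add_zero]

/-! ### Bipartite and even subgraphs in terms of flags -/

variable {H : Graph G.Vertex E}

theorem isLink_of_edge_mem (hH : H ≤ G.toGraph) {f : F} (hf : G.edge f ∈ E(H)) :
    H.IsLink (G.edge f) (G.vertexOf f) (G.vertexOf (G.τ₀ f)) :=
  (hH.isLink_iff hf).2 ⟨f, rfl, rfl, rfl⟩

theorem coboundary_edge (G : RibbonGraph F E V₀) (c : G.Vertex → ZMod 2) (f : F) :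
    coboundary G.toGraph c (G.edge f) = c (G.vertexOf f) + c (G.vertexOf (G.τ₀ f)) :=
  coboundary_of_isLink (H := G.toGraph) ⟨f, rfl, rfl, rfl⟩ c

theorem bipartite_iff (hH : H ≤ G.toGraph) :
    H.Bipartite ↔ ∃ c, G.HasJump 0 c ∧ ∀ f, G.edge f ∈ E(H) → c (G.τ₀ f) = c f + 1 := by
  constructor
  · rintro ⟨color, hcolor⟩
    let c : G.Vertex → ZMod 2 := fun x => if color x then 1 else 0
    refine ⟨c ∘ G.vertexOf, G.hasJump_zero_comp_vertexOf c, fun f hf => ?_⟩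
    have hne := hcolor (isLink_of_edge_mem hH hf)
    simp only [Function.comp_apply, c]
    grind
  · rintro ⟨c, hc, hc₀⟩
    refine ⟨vertexLift (fun f => decide (c f = 1)) (fun _ => false)
      (fun f => by rw [hc.apply_τ₁]) (fun f => by simp [hc.apply_τ₂]), fun e x y he => ?_⟩
    obtain ⟨f, rfl, rfl, rfl⟩ := hH.isLink_mono he
    rw [vertexLift_vertexOf, vertexLift_vertexOf, hc₀ f he.edge_mem]
    generalize c f = a
    revert a
    decide

theorem toGraph_bipartite_iff :
    G.toGraph.Bipartite ↔ ∃ c, G.HasJump 0 c ∧ G.dual.HasJump 1 c := by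
  rw [bipartite_iff le_rfl]
  refine exists_congr fun c => and_congr_right fun hc => ?_
  simp only [edgeSet_toGraph, Set.mem_univ, forall_const]
  exact ⟨fun h => ⟨hc.apply_τ₁, h⟩, fun h => h.apply_τ₂⟩

theorem edgeInduce_bipartite_iff {A : Set E} :
    (G.toGraph.edgeInduce A).Bipartite ↔
      ∃ c, G.HasJump 0 c ∧ ∀ f, G.edge f ∈ A → c (G.τ₀ f) = c f + 1 := by
  rw [bipartite_iff (edgeInduce_le _ _), edgeSet_edgeInduce_toGraph]

theorem HasJump.hasEvenDegrees [Finite F] [Finite V₀] (hH : H ≤ G.toGraph)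
    (hh : G.HasJump (E(H).indicator 1) h) : HasEvenDegrees H := by
  have := G.finite_edges
  have := Fintype.ofFinite E
  refine hasEvenDegrees_iff_sum.2 fun c => ?_
  refine sum_edge_eq_zero (G := G) (u := fun f => h f * c (G.vertexOf f))
    (fun f => by simp only [hh.apply_τ₁, vertexOf_τ₁]) fun f => ?_
  have hcorners : coboundary H c (G.edge f) =
      E(H).indicator 1 (G.edge f) * (c (G.vertexOf f) + c (G.vertexOf (G.τ₀ f))) := by
    by_cases hf : G.edge f ∈ E(H)
    · simp [hf, coboundary_of_isLink (isLink_of_edge_mem hH hf)]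
    · simp [hf, coboundary_of_notMem hf]
  rw [hcorners, G.τ₀_τ₂, vertexOf_τ₂, vertexOf_τ₂, hh.apply_τ₂, hh.apply_τ₂, G.edge_τ₀]
  grind

theorem exists_hasJump_of_hasEvenDegrees [Finite F] [Finite V₀] (hH : H ≤ G.toGraph)
    (heven : HasEvenDegrees H) : ∃ h, G.HasJump (E(H).indicator 1) h := by
  have := G.finite_edges
  have := Fintype.ofFinite E
  have := Fintype.ofFinite F
  obtain ⟨h, hh⟩ := exists_symmetrize_symmetrize_eq (K := ZMod 2) G.τ₂_invol G.τ₁_invol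
      (s := E(H).indicator 1 ∘ G.edge) fun w hw => by
    let u := symmetrize (ZMod 2) G.τ₂ w
    have hu₂ : ∀ f, u (G.τ₂ f) = u f := symmetrize_apply_involutive G.τ₂_invol w
    have hu₁ : ∀ f, u (G.τ₁ f) = u f := fun f => (CharTwo.add_eq_zero.1 (congrFun hw f)).symm
    rw [dotProduct, ← hasEvenDegrees_iff_sum.1 heven (vertexLift u 0 hu₁ hu₂)]
    refine (sum_edge_eq_sum_flag (G := G) fun f => ?_).symm
    by_cases hf : G.edge f ∈ E(H)
    · rw [coboundary_of_isLink (isLink_of_edge_mem hH hf)]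
      simp only [vertexLift_vertexOf, u, symmetrize_apply, G.τ₀_τ₂, Function.comp_apply, edge_τ₀,
        edge_τ₂, Set.indicator_of_mem hf, Pi.one_apply]
      ring
    · simp [coboundary_of_notMem hf, hf, edge_τ₀, edge_τ₂]
  refine ⟨symmetrize _ G.τ₁ h, symmetrize_apply_involutive G.τ₁_invol h, fun f => ?_⟩
  have hf : symmetrize _ G.τ₁ h f + symmetrize _ G.τ₁ h (G.τ₂ f) = E(H).indicator 1 (G.edge f) :=
    congrFun hh f
  grind

theorem hasEvenDegrees_iff [Finite F] [Finite V₀] (hH : H ≤ G.toGraph) :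
    HasEvenDegrees H ↔ ∃ h, G.HasJump (E(H).indicator 1) h :=
  ⟨exists_hasJump_of_hasEvenDegrees hH, fun ⟨_, hh⟩ => hh.hasEvenDegrees hH⟩

theorem toGraph_hasEvenDegrees_iff [Finite F] [Finite V₀] :
    HasEvenDegrees G.toGraph ↔ ∃ h, G.HasJump 1 h := by
  rw [hasEvenDegrees_iff le_rfl, edgeSet_toGraph, Set.indicator_univ]

theorem edgeInduce_hasEvenDegrees_iff [Finite F] [Finite V₀] {A : Set E} :
    HasEvenDegrees (G.toGraph.edgeInduce A) ↔ ∃ h, G.HasJump (A.indicator 1) h := by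
  rw [hasEvenDegrees_iff (edgeInduce_le _ _), edgeSet_edgeInduce_toGraph]

/-! ### Splitting balanced functions on plane graphs -/

theorem IsBalanced.sum_mul_coboundary_dual [Finite F] [Fintype E] (hg : G.IsBalanced g)
    {a : E → ZMod 2} (ha : ∀ f, a (G.edge f) = g f + g (G.τ₀ f)) (d : G.dual.Vertex → ZMod 2) :
    ∑ e, coboundary G.dual.toGraph d e * a e = 0 := by
  refine sum_edge_eq_zero (G := G) (u := fun f => g f * d (G.dual.vertexOf f)) (fun f => ?_)
    fun f => ?_
  · rw [hg.apply_τ₁, show G.dual.vertexOf (G.τ₁ f) = _ from G.dual.vertexOf_τ₁ f]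
  · have hτ₀ : ∀ f, G.dual.vertexOf (G.τ₀ f) = G.dual.vertexOf f := G.dual.vertexOf_τ₂
    have hδ : coboundary G.dual.toGraph d (G.edge f) =
        d (G.dual.vertexOf f) + d (G.dual.vertexOf (G.τ₂ f)) := G.dual.coboundary_edge d f
    have hcorners := hg.sum_corners f
    rw [hδ, ha, hτ₀, hτ₀]
    grind

theorem IsPlane.exists_coboundary_eq [Finite F] [Fintype E] [Finite V₀] (hG : G.IsPlane)
    {a : E → ZMod 2} (ha : ∀ d, ∑ e, coboundary G.dual.toGraph d e * a e = 0) :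
    ∃ c, coboundary G.toGraph c = a := by
  have := Fintype.ofFinite G.Vertex
  have := Fintype.ofFinite G.dual.Vertex
  have hdual : G.dual.toGraph.Connected :=
    connected_toGraph_of_edge_eq_of_τ₁_eq (G := G) rfl rfl hG.1
  refine LinearMap.mem_range.1 (mem_of_forall_dotProduct_eq_zero
    (q := LinearMap.range (coboundary G.dual.toGraph)) ?_ ?_ ?_)
  · rintro _ ⟨c, rfl⟩ _ ⟨d, rfl⟩
    exact (G.hasJump_zero_comp_vertexOf c).isBalanced.sum_mul_coboundary_dual
      (G.coboundary_edge c) d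
  · have heuler :
        (Fintype.card G.Vertex : ℤ) - Fintype.card E + Fintype.card G.dual.Vertex = 2 := by
      have hχ : (Nat.card G.Vertex : ℤ) - Nat.card E + Nat.card G.dual.Vertex = 2 := hG.2
      simpa only [Nat.card_eq_fintype_card] using hχ
    have hker := finrank_ker_coboundary_le_one hG.1 rfl
    have hker' := finrank_ker_coboundary_le_one hdual rfl
    have hrank := (coboundary G.toGraph).finrank_range_add_finrank_ker
    have hrank' := (coboundary G.dual.toGraph).finrank_range_add_finrank_ker
    rw [Module.finrank_fintype_fun_eq_card] at hrank hrank'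
    omega
  · rintro _ ⟨d, rfl⟩
    exact ha d

theorem IsPlane.exists_eq_add [Finite F] [Finite V₀] (hG : G.IsPlane)
    (hg : G.IsBalanced g) : ∃ c d, G.HasJump 0 c ∧ G.dual.HasJump 0 d ∧ g = c + d := by
  have := G.finite_edges
  have := Fintype.ofFinite E
  obtain ⟨a, ha⟩ : ∃ a : E → ZMod 2, ∀ f, a (G.edge f) = g f + g (G.τ₀ f) :=
    exists_comp_edge_eq (fun f => by rw [G.τ₀_invol, add_comm]) fun f => by
      have := hg.sum_corners f
      grind
  obtain ⟨c, rfl⟩ := hG.exists_coboundary_eq (hg.sum_mul_coboundary_dual ha)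
  have hc := G.hasJump_zero_comp_vertexOf c
  refine ⟨c ∘ G.vertexOf, g + c ∘ G.vertexOf, hc, ⟨fun f => ?_, fun f => ?_⟩, ?_⟩
  · exact (hg.add hc.isBalanced).apply_τ₁ f
  · have hf := ha f
    rw [coboundary_edge] at hf
    change g (G.τ₀ f) + c (G.vertexOf (G.τ₀ f)) = g f + c (G.vertexOf f) + 0
    grind
  · funext f
    simp only [Pi.add_apply]
    grind

/-! ### Partial duals -/

variable {A : Set E} {f : F}

theorem partialDual_τ₂_of_mem (hf : G.edge f ∈ A) : (G.partialDual A).τ₂ f = G.τ₀ f :=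
  if_neg (not_not_intro hf)

theorem partialDual_τ₂_of_notMem (hf : G.edge f ∉ A) : (G.partialDual A).τ₂ f = G.τ₂ f :=
  if_pos hf

theorem dual_partialDual (G : RibbonGraph F E V₀) (A : Set E) :
    (G.partialDual A).dual = G.partialDual Aᶜ := by
  simp only [dual, partialDual, hide, ArrowMarkedRibbonGraph.restore, ArrowMarkedRibbonGraph.dual]
  congr 1 <;> funext f <;> by_cases hf : G.edge f ∈ A <;>
    simp [ArrowMarkedRibbonGraph.crossStep, ArrowMarkedRibbonGraph.boundaryStep, hf]

theorem partialDual_hasJump_iff :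
    (G.partialDual A).HasJump s h ↔ (∀ f, h (G.τ₁ f) = h f) ∧
      (∀ f, G.edge f ∈ A → h (G.τ₀ f) = h f + s (G.edge f)) ∧
      ∀ f, G.edge f ∉ A → h (G.τ₂ f) = h f + s (G.edge f) := by
  constructor
  · refine fun hh => ⟨hh.apply_τ₁, fun f hf => ?_, fun f hf => ?_⟩
    · rw [← partialDual_τ₂_of_mem hf]
      exact hh.apply_τ₂ f
    · rw [← partialDual_τ₂_of_notMem hf]
      exact hh.apply_τ₂ f
  · rintro ⟨h₁, h₀, h₂⟩
    refine ⟨h₁, fun f => ?_⟩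
    by_cases hf : G.edge f ∈ A
    · rw [partialDual_τ₂_of_mem hf]
      exact h₀ f hf
    · rw [partialDual_τ₂_of_notMem hf]
      exact h₂ f hf

theorem partialDual_bipartite_iff_exists_hasJump :
    (G.partialDual A).toGraph.Bipartite ↔
      ∃ h, G.HasJump (A.indicator 1) h ∧ G.dual.HasJump (Aᶜ.indicator 1) h := by
  rw [toGraph_bipartite_iff]
  refine exists_congr fun h => ?_
  rw [dual_partialDual, partialDual_hasJump_iff, partialDual_hasJump_iff]
  constructor
  · rintro ⟨⟨h₁, h₀, h₂⟩, -, h₀', h₂'⟩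
    refine ⟨⟨h₁, fun f => ?_⟩, h₁, fun f => ?_⟩ <;> by_cases hf : G.edge f ∈ A
    · simpa [hf] using h₂' f (not_not_intro hf)
    · simpa [hf] using h₂ f hf
    · exact (h₀ f hf).trans (by simp [dual, hf])
    · exact (h₀' f hf).trans (by simp [dual, hf])
  · rintro ⟨hh, hh'⟩
    have h₀ : ∀ f, h (G.τ₀ f) = h f + Aᶜ.indicator 1 (G.edge f) := hh'.apply_τ₂
    refine ⟨⟨hh.apply_τ₁, fun f hf => ?_, fun f hf => ?_⟩,
      hh.apply_τ₁, fun f hf => ?_, fun f hf => ?_⟩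
    · simp [h₀, hf]
    · simp [hh.apply_τ₂, hf]
    · simp [h₀, Set.indicator_of_mem hf]
    · simp [hh.apply_τ₂, Set.notMem_compl_iff.1 hf]

theorem isBalanced_of_partialDual_hasJump (hh : (G.partialDual A).HasJump s h) :
    G.IsBalanced h := by
  obtain ⟨h₁, h₀, h₂⟩ := partialDual_hasJump_iff.1 hh
  refine ⟨h₁, fun f => ?_⟩
  by_cases hf : G.edge f ∈ A
  · rw [h₀ f hf, h₀ (G.τ₂ f) (by rwa [G.edge_τ₂]), G.edge_τ₂]
    grind
  · rw [G.τ₀_τ₂, h₂ f hf, h₂ (G.τ₀ f) (by rwa [G.edge_τ₀]), G.edge_τ₀]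
    grind

theorem IsPlane.partialDual_bipartite_iff [Finite F] [Finite V₀] (hG : G.IsPlane) :
    (G.partialDual A).toGraph.Bipartite ↔
      HasEvenDegrees (G.toGraph.edgeInduce A) ∧ HasEvenDegrees (G.dual.toGraph.edgeInduce Aᶜ) := by
  rw [partialDual_bipartite_iff_exists_hasJump, edgeInduce_hasEvenDegrees_iff,
    edgeInduce_hasEvenDegrees_iff]
  refine ⟨fun ⟨h, hh, hh'⟩ => ⟨⟨h, hh⟩, h, hh'⟩, fun ⟨⟨h, hh⟩, h', hh'⟩ => ?_⟩
  obtain ⟨c, d, hc, hd, hcd⟩ :=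
    hG.exists_eq_add (hh.isBalanced.add (isBalanced_of_dual hh'.isBalanced))
  have heq : h + c = h' + d := funext fun f => by
    have hf := congrFun hcd f
    simp only [Pi.add_apply] at hf ⊢
    grind
  refine ⟨h + c, ?_, heq ▸ ?_⟩
  · simpa only [add_zero] using hh.add hc
  · simpa only [add_zero] using hh'.add hd

theorem IsPlane.partialDual_hasEvenDegrees_iff [Finite F] [Finite V₀] (hG : G.IsPlane) :
    HasEvenDegrees (G.partialDual A).toGraph ↔
      (G.toGraph.edgeInduce A).Bipartite ∧ (G.dual.toGraph.edgeInduce Aᶜ).Bipartite := by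
  rw [toGraph_hasEvenDegrees_iff, edgeInduce_bipartite_iff, edgeInduce_bipartite_iff]
  constructor
  · rintro ⟨h, hh⟩
    obtain ⟨c, d, hc, hd, rfl⟩ := hG.exists_eq_add (isBalanced_of_partialDual_hasJump hh)
    obtain ⟨-, h₀, h₂⟩ := partialDual_hasJump_iff.1 hh
    have hc₂ : ∀ f, c (G.τ₂ f) = c f + 0 := hc.apply_τ₂
    have hd₀ : ∀ f, d (G.τ₀ f) = d f + 0 := hd.apply_τ₂
    simp only [Pi.add_apply, Pi.one_apply] at h₀ h₂
    refine ⟨⟨c, hc, fun f hf => ?_⟩, d, hd, fun f hf => ?_⟩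
    · linear_combination h₀ f hf - hd₀ f
    · exact show d (G.τ₂ f) = d f + 1 by linear_combination h₂ f hf - hc₂ f
  · rintro ⟨⟨c, hc, hc₀⟩, d, hd, hd₂⟩
    replace hd₂ : ∀ f, G.edge f ∈ Aᶜ → d (G.τ₂ f) = d f + 1 := hd₂
    have hd₁ : ∀ f, d (G.τ₁ f) = d f := hd.apply_τ₁
    have hd₀ : ∀ f, d (G.τ₀ f) = d f + 0 := hd.apply_τ₂
    have hc₂ : ∀ f, c (G.τ₂ f) = c f + 0 := hc.apply_τ₂
    refine ⟨c + d, partialDual_hasJump_iff.2 ⟨fun f => ?_, fun f hf => ?_, fun f hf => ?_⟩⟩ <;>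
      simp only [Pi.add_apply, Pi.one_apply]
    · rw [hc.apply_τ₁, hd₁]
    · linear_combination hc₀ f hf + hd₀ f
    · linear_combination hc₂ f + hd₂ f hf

end RibbonGraph

theorem theorem3p3 {F E V₀ : Type*} [Finite F] [Finite V₀]
    (G : RibbonGraph F E V₀) (hG : G.IsPlane) (A : Set E) :
    ((G.partialDual A).toGraph.Bipartite ↔
      (∀ C : Graph G.Vertex E, C.IsComponent (G.toGraph.edgeInduce A) → C.Eulerian) ∧
        (∀ C : Graph G.dual.Vertex E, C.IsComponent (G.dual.toGraph.edgeInduce Aᶜ) → C.Eulerian)) ∧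
    ((G.partialDual A).toGraph.Eulerian ↔
      (G.toGraph.edgeInduce A).Bipartite ∧ (G.dual.toGraph.edgeInduce Aᶜ).Bipartite) := by
  have := G.finite_edges
  have hconn : (G.partialDual A).toGraph.Connected :=
    RibbonGraph.connected_toGraph_of_edge_eq_of_τ₁_eq (G := G) rfl rfl hG.1
  constructor
  · rw [hG.partialDual_bipartite_iff, Multigraph.forall_isComponent_eulerian_iff,
      Multigraph.forall_isComponent_eulerian_iff]
  · rw [Multigraph.eulerian_iff, and_iff_right hconn, hG.partialDual_hasEvenDegrees_iff]
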